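/- Consider the linear Gaussian system with scalar output \[ x_{k+1} = A x_k + w_k,\quad w_k \sim \mathcal N(0,Q), \qquad y_k = C x_k + v_k \in \mathbb{R},\quad v_k \sim \mathcal N(0,R), \] where $x_k \in \mathbb{R}^n$, each of the noise sequences $(w_k)$ and $(v_k)$ is i.i.d., and the two sequences are independent of each other. Let the system be in steady state: the initial state is independent of the noises and has law $\mathcal N(0,\Sigma^x)$, where $\Sigma^x$ is positive semidefinite and $\Sigma^x = A\Sigma^xA^\top + Q$. Let $\sigma_\gamma^2 = C\Sigma^xC^\top + R$ be the variance of the measurements. For two candidate variances $\sigma_\alpha^2, \sigma_\beta^2 > 0$, let \[ \mathcal L_N = \sum_{k=1}^N \log\frac{p(y_k\mid\alpha)}{p(y_k\mid\beta)} \] be the cumulative log-likelihood ratio of the first $N$ measurements, where $p(\cdot\mid\alpha)$ and $p(\cdot\mid\beta)$ are the densities of $\mathcal N(0,\sigma_\alpha^2)$ and $\mathcal N(0,\sigma_\beta^2)$. Put \[ \mu_N = \frac N2\Bigl[\log\frac{\sigma_\beta^2}{\sigma_\alpha^2} + (\sigma_\beta^{-2}-\sigma_\alpha^{-2})\sigma_\gamma^2\Bigr],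 \qquad \sigma_{\mathrm{uncorr},N}^2 = \frac N2 \bigl[(\sigma_\beta^{-2}-\sigma_\alpha^{-2})\sigma_\gamma^2\bigr]^2, \] which are the mean and the variance of $\mathcal L_N$ for uncorrelated measurements. Suppose that there is $\lambda \in [0,1)$ with $\mathbb{E}[y_k y_{k+t}] = \lambda^t\, \mathbb{E}[y_k^2]$ for all $k$ and all $t \ge 0$, and put \[ \sigma_N^2 = \sigma_{\mathrm{uncorr},N}^2\,\frac{1+\lambda^2}{1-\lambda^2}. \] Then, as $N \to \infty$, $\mathcal L_N$ is asymptotically normal with mean $\mu_N$ and variance $\sigma_N^2$, in the following sense. The sequence $(\mathcal L_N - \mu_N)/\sqrt N$ converges in distribution to $\mathcal N(0,\sigma_1^2)$, where $\sigma_1^2 = \sigma_N^2/N$ is $\sigma_N^2$ at $N=1$ (a point mass at $0$ if $\sigma_1^2 = 0$); and if $\sigma_\alpha^2 \neq \sigma_\beta^2$ and $\sigma_\gamma^2 \neq 0$, then $(\mathcal L_N - \mu_N)/\sigma_N$ converges in distribution to $\mathcal N(0,1)$. Moreover, $\mathcal L_N$ is square integrable with $\mathbb{E}[\mathcal L_N]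 = \mu_N$ for every $N$, and $\operatorname{Var}(\mathcal L_N)/N \to \sigma_1^2$. -/

import Mathlib

open MeasureTheory ProbabilityTheory Filter Topology
open scoped NNReal Matrix

noncomputable section

/-- A discrete-time linear Gaussian system with state in `ℝⁿ` and scalar measurements,
`x_{k+1} = A x_k + w_k` with `w_k ∼ N(0, Q)`, and `y_k = C x_k + v_k` with `v_k ∼ N(0, R)`. -/
structure LinearGaussianSystem (n : ℕ) where
  /-- transition matrix -/
  A : Matrix (Fin n) (Fin n) ℝ
  /-- observation matrix, a single row because the measurements are scalar -/
  C : Fin n → ℝ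
  /-- covariance of the process noise -/
  Q : Matrix (Fin n) (Fin n) ℝ
  /-- variance of the observation noise -/
  R : ℝ≥0
  /-- `Q` is a covariance matrix -/
  Q_posSemidef : Q.PosSemidef

namespace LinearGaussianSystem

variable {n : ℕ}

/-- `S` is a steady-state covariance of the state: a positive semidefinite solution of the
discrete Lyapunov equation `S = A S Aᵀ + Q`. -/
structure IsSteadyStateCov (sys : LinearGaussianSystem n)
    (S : Matrix (Fin n) (Fin n) ℝ) : Prop where
  posSemidef : S.PosSemidef
  lyapunov : S = sys.A * S * sys.Aᵀ + sys.Q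

/-- The steady-state variance `C S Cᵀ + R` of a measurement. -/
def outputVar (sys : LinearGaussianSystem n) (S : Matrix (Fin n) (Fin n) ℝ) : ℝ :=
  sys.C ⬝ᵥ (S *ᵥ sys.C) + (sys.R : ℝ)

/-- `y` is the sequence of measurements of the system `sys` running in steady state with state
covariance `S`, with states `x`, process noise `w` and observation noise `v`. -/
structure IsSteadyStateRun (sys : LinearGaussianSystem n) (S : Matrix (Fin n) (Fin n) ℝ)
    {Ω : Type*} [MeasurableSpace Ω] (P : Measure Ω)
    (x w : ℕ → Ω → EuclideanSpace ℝ (Fin n)) (v y : ℕ → Ω → ℝ) : Prop where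
  cov : sys.IsSteadyStateCov S
  law_init : HasLaw (x 0) (multivariateGaussian 0 S) P
  law_w : ∀ k, HasLaw (w k) (multivariateGaussian 0 sys.Q) P
  law_v : ∀ k, HasLaw (v k) (gaussianReal 0 sys.R) P
  indep_w : iIndepFun w P
  indep_v : iIndepFun v P
  indep_noises : IndepFun (fun ω k ↦ w k ω) (fun ω k ↦ v k ω) P
  indep_init : IndepFun (x 0) (fun ω ↦ (fun k ↦ w k ω, fun k ↦ v k ω)) P
  state_eq : ∀ k ω, x (k + 1) ω = WithLp.toLp 2 (sys.A *ᵥ (x k ω).ofLp) + w k ω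
  output_eq : ∀ k ω, y k ω = sys.C ⬝ᵥ (x k ω).ofLp + v k ω

end LinearGaussianSystem

/-- The cumulative log-likelihood ratio of the first `N` measurements between the hypotheses
`N(0, sα)` and `N(0, sβ)`, where `sα` and `sβ` are variances. -/
def logLikelihoodRatio {Ω : Type*} (sα sβ : ℝ≥0) (y : ℕ → Ω → ℝ) (N : ℕ) (ω : Ω) : ℝ :=
  ∑ k ∈ Finset.range N,
    Real.log (gaussianPDFReal 0 sα (y k ω) / gaussianPDFReal 0 sβ (y k ω))

/-- Mean of the normal approximation of the log-likelihood ratio of `N` independent measurements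
with variance `sγ`: `(N / 2) [log (sβ / sα) + (sβ⁻¹ - sα⁻¹) sγ]`. -/
def uncorrMean (sα sβ : ℝ≥0) (sγ : ℝ) (N : ℕ) : ℝ :=
  (N : ℝ) / 2 * (Real.log ((sβ : ℝ) / sα) + ((sβ : ℝ)⁻¹ - (sα : ℝ)⁻¹) * sγ)

/-- Variance of the normal approximation of the log-likelihood ratio of `N` independent
measurements with variance `sγ`: `(N / 2) [(sβ⁻¹ - sα⁻¹) sγ (sβ⁻¹ - sα⁻¹) sγ]`. -/
def uncorrVar (sα sβ : ℝ≥0) (sγ : ℝ) (N : ℕ) : ℝ :=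
  (N : ℝ) / 2 *
    (((sβ : ℝ)⁻¹ - (sα : ℝ)⁻¹) * sγ * ((sβ : ℝ)⁻¹ - (sα : ℝ)⁻¹) * sγ)

/-- Variance of the normal approximation for measurements with correlation `r ^ t` at lag `t`. -/
def corrVar (sα sβ : ℝ≥0) (sγ r : ℝ) (N : ℕ) : ℝ :=
  uncorrVar sα sβ sγ N * ((1 + r ^ 2) / (1 - r ^ 2))

end

/-!
The log-likelihood ratio of a single measurement `y` is affine in `y²`, so up to its mean the
cumulative ratio is `(c / 2) * (∑ k < N, y_k² - N * s)`, with `c = sβ⁻¹ - sα⁻¹` and `s` the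
steady-state output variance: a centred quadratic form in the Gaussian vector `(y_0, …, y_{N-1})`,
whose covariance matrix is `s * r ^ |i - j|`.

Diagonalizing this covariance matrix turns `∑ y_k²` into `∑ Z_i²` with independent
`Z_i ∼ N(0, l_i)`, where the `l_i` are the eigenvalues
(`ProbabilityTheory.HasGaussianLaw.exists_diagonalization`). Three spectral quantities matter.
The trace `∑ l_i = N * s` gives the mean. The squared Frobenius norm
`∑ l_i² = s² * ∑ i j, r ^ (2 |i - j|)` gives the variance, and divided by `N` it converges to
`s² * (1 + r²) / (1 - r²)` by a Cesàro argument (`tendsto_sum_sum_pow_dist`). Finally Gershgorin's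
theorem bounds all `l_i` by `2 * s / (1 - r)`, uniformly in `N`, so that no summand dominates.

With these facts the sums `∑ (Z_i² - l_i)` form a triangular array of scaled centred chi-square
variables, and their characteristic functions converge to the Gaussian one
(`tendsto_charFun_sum_sq_sub`); convergence in distribution is then Lévy's theorem. No
nondegeneracy is needed on the `√N` scale: if `c * s = 0` the limit is a point mass.
-/

/-! ### Diagonalization of Gaussian quadratic forms -/

/-- Both sides are the trace of `K * K`. -/
theorem Matrix.IsHermitian.sum_sq_eigenvalues {ι : Type*} [Fintype ι] [DecidableEq ι]
    {K : Matrix ι ι ℝ} (hK : K.IsHermitian) :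
    ∑ i, hK.eigenvalues i ^ 2 = ∑ i, ∑ j, K i j ^ 2 := by
  have h1 : ∑ i, ∑ j, K i j ^ 2 = (K * K).trace := by
    simp only [Matrix.trace, Matrix.diag_apply, Matrix.mul_apply]
    refine Finset.sum_congr rfl fun i _ ↦ Finset.sum_congr rfl fun j _ ↦ ?_
    have := hK.apply i j
    rw [star_trivial] at this
    rw [this, sq]
  rw [h1]
  conv_rhs => rw [hK.spectral_theorem, ← map_mul, Unitary.conjStarAlgAut_apply,
    Matrix.trace_mul_cycle, Unitary.coe_star_mul_self, one_mul, Matrix.diagonal_mul_diagonal,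
    Matrix.trace_diagonal]
  simp [sq]

/-- A one-sided form of Gershgorin's theorem: eigenvalues are at most the
largest absolute row sum. -/
theorem Matrix.IsHermitian.exists_eigenvalue_le_sum_abs {ι : Type*} [Fintype ι] [DecidableEq ι]
    {K : Matrix ι ι ℝ} (hK : K.IsHermitian) (i : ι) :
    ∃ k, hK.eigenvalues i ≤ ∑ j, |K k j| := by
  have hev : Module.End.HasEigenvalue (Matrix.toLin' K) (hK.eigenvalues i) := by
    refine Module.End.hasEigenvalue_of_hasEigenvector (x := (hK.eigenvectorBasis i).ofLp) ?_
    refine ⟨Module.End.mem_eigenspace_iff.2 ?_, ?_⟩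
    · simpa using hK.mulVec_eigenvectorBasis i
    · exact (WithLp.ofLp_eq_zero 2).ne.2 <| hK.eigenvectorBasis.orthonormal.ne_zero i
  obtain ⟨k, hk⟩ := eigenvalue_mem_ball hev
  refine ⟨k, ?_⟩
  rw [Metric.mem_closedBall, Real.dist_eq] at hk
  rw [← Finset.add_sum_erase _ _ (Finset.mem_univ k)]
  have := le_abs_self (K k k)
  have := le_abs_self (hK.eigenvalues i - K k k)
  simp only [Real.norm_eq_abs] at hk
  linarith

/-- The sum of squares of a centred Gaussian vector is a sum of squares of independent centred
Gaussians `Z i`, whose variances `l i` are the eigenvalues of the covariance matrix. The `Z i` are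
the coordinates of the vector in an orthonormal eigenbasis: they are jointly Gaussian and
uncorrelated, hence independent, and the change of basis is an isometry. The variances enter the
limit theorem only through their sum, their sum of squares and an upper bound. -/
theorem ProbabilityTheory.HasGaussianLaw.exists_diagonalization {ι Ω : Type*} [Fintype ι]
    [MeasurableSpace Ω] {P : Measure Ω} {Y : ι → Ω → ℝ}
    (hY : HasGaussianLaw (fun ω i ↦ Y i ω) P) (hmean : ∀ i, ∫ ω, Y i ω ∂P = 0) :
    ∃ (l : ι → ℝ≥0) (Z : ι → Ω → ℝ), iIndepFun Z P ∧
      (∀ i, HasLaw (Z i) (gaussianReal 0 (l i)) P) ∧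
      (∀ ω, ∑ i, Y i ω ^ 2 = ∑ i, Z i ω ^ 2) ∧
      ∑ i, (l i : ℝ) = ∑ i, cov[Y i, Y i; P] ∧
      ∑ i, (l i : ℝ) ^ 2 = ∑ i, ∑ j, cov[Y i, Y j; P] ^ 2 ∧
      ∀ i, ∃ k, (l i : ℝ) ≤ ∑ j, |cov[Y k, Y j; P]| := by
  classical
  have := hY.isProbabilityMeasure
  have hY2 i : MemLp (Y i) 2 P := (hY.eval i).memLp_two
  let K : Matrix ι ι ℝ := Matrix.of fun i j ↦ cov[Y i, Y j; P]
  have hK : K.IsHermitian := Matrix.IsHermitian.ext fun i j ↦ by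
    simp [K, covariance_comm (Y i)]
  -- the coordinates in the orthonormal eigenbasis `b` of the covariance matrix
  let b := hK.eigenvectorBasis
  let Z : ι → Ω → ℝ := fun i ω ↦ ∑ j, (b i) j * Y j ω
  have hZ : HasGaussianLaw (fun ω i ↦ Z i ω) P := by
    let T : (ι → ℝ) →L[ℝ] (ι → ℝ) :=
      ContinuousLinearMap.pi fun i ↦ ∑ j, (b i) j • ContinuousLinearMap.proj j
    have hT : (fun ω i ↦ Z i ω) = fun ω ↦ T fun i ↦ Y i ω := by
      ext ω i
      simp [T, Z]
    rw [hT]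
    exact hY.map_fun T
  have hcov i j : cov[Z i, Z j; P] = if i = j then hK.eigenvalues i else 0 := by
    have h1 : cov[Z i, Z j; P] = (b i).ofLp ⬝ᵥ (K *ᵥ (b j).ofLp) := by
      simp only [Z]
      rw [covariance_fun_sum_fun_sum (fun k ↦ (hY2 k).const_mul _) (fun k ↦ (hY2 k).const_mul _)]
      simp only [covariance_const_mul_left, covariance_const_mul_right, dotProduct, Matrix.mulVec,
        Finset.mul_sum, K, Matrix.of_apply]
      refine Finset.sum_congr rfl fun k _ ↦ Finset.sum_congr rfl fun l _ ↦ by ring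
    have h2 := orthonormal_iff_ite.1 b.orthonormal i j
    rw [h1, hK.mulVec_eigenvectorBasis, dotProduct_smul]
    rw [EuclideanSpace.inner_eq_star_dotProduct, star_trivial, dotProduct_comm] at h2
    rw [h2]
    split_ifs with h <;> simp [h]
  have hvar i : Var[Z i; P] = hK.eigenvalues i := by
    rw [← covariance_self (hZ.eval i).aemeasurable, hcov, if_pos rfl]
  have hnn i : 0 ≤ hK.eigenvalues i := hvar i ▸ variance_nonneg _ _
  have hZmean i : ∫ ω, Z i ω ∂P = 0 := by
    simp only [Z]
    rw [integral_finsetSum _ fun j _ ↦ ((hY2 j).integrable one_le_two).const_mul _]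
    simp [integral_const_mul, hmean]
  refine ⟨fun i ↦ (hK.eigenvalues i).toNNReal, Z, ?_, fun i ↦ ⟨(hZ.eval i).aemeasurable, ?_⟩, ?_,
    ?_, ?_, ?_⟩
  · exact hZ.iIndepFun_of_covariance_eq_zero fun i j hij ↦ by rw [hcov, if_neg hij]
  · rw [(hZ.eval i).map_eq_gaussianReal, hZmean, hvar]
  · intro ω
    have h := b.sum_sq_norm_inner_right (WithLp.toLp 2 fun i ↦ Y i ω)
    rw [EuclideanSpace.norm_sq_eq] at h
    simp only [Real.norm_eq_abs, sq_abs, PiLp.inner_apply] at h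
    rw [← h]
    simp [Z, mul_comm]
  · simp only [Real.coe_toNNReal _ (hnn _)]
    exact (hK.trace_eq_sum_eigenvalues).symm
  · simp only [Real.coe_toNNReal _ (hnn _)]
    exact hK.sum_sq_eigenvalues
  · simp only [Real.coe_toNNReal _ (hnn _)]
    exact hK.exists_eigenvalue_le_sum_abs

/-! ### Squares of centred Gaussian variables -/

/-- One step of the computation of the derivatives of the moment-generating function of
`N(0, v)`. -/
theorem hasDerivAt_mul_exp_half_sq {p : ℝ → ℝ} {p' : ℝ} (v t : ℝ) (hp : HasDerivAt p p' t) :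
    HasDerivAt (fun s ↦ p s * Real.exp (v * s ^ 2 / 2))
      ((p' + v * t * p t) * Real.exp (v * t ^ 2 / 2)) t := by
  have h : HasDerivAt (fun s : ℝ ↦ Real.exp (v * s ^ 2 / 2))
      (Real.exp (v * t ^ 2 / 2) * (v * t)) t := by
    have h1 := (((hasDerivAt_id t).pow 2).const_mul v).div_const 2
    convert! h1.exp using 1
    simp
    ring
  convert! hp.mul h using 1
  ring

/-- The second and fourth derivatives at `0` of `t ↦ exp (v t² / 2)`. -/
theorem iteratedDeriv_mgf_id_gaussianReal (v : ℝ≥0) :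
    iteratedDeriv 2 (mgf id (gaussianReal 0 v)) 0 = v ∧
      iteratedDeriv 4 (mgf id (gaussianReal 0 v)) 0 = 3 * (v : ℝ) ^ 2 := by
  have h0 : mgf id (gaussianReal 0 v) = fun t : ℝ ↦ 1 * Real.exp (v * t ^ 2 / 2) := by
    ext t
    rw [mgf_gaussianReal Measure.map_id]
    simp
  have hd : ∀ p p' : ℝ → ℝ, (∀ t, HasDerivAt p (p' t) t) →
      deriv (fun s ↦ p s * Real.exp (v * s ^ 2 / 2)) =
        fun t ↦ (p' t + v * t * p t) * Real.exp (v * t ^ 2 / 2) := fun p p' hp ↦ by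
    ext t
    exact (hasDerivAt_mul_exp_half_sq v t (hp t)).deriv
  have h1 := hd (fun _ ↦ 1) (fun _ ↦ 0) fun t ↦ hasDerivAt_const t 1
  have h2 := hd (fun t ↦ v * t) (fun _ ↦ v) fun t ↦ by
    simpa using (hasDerivAt_id t).const_mul (v : ℝ)
  have h3 := hd (fun t ↦ v + v * t * (v * t)) (fun t ↦ 2 * v ^ 2 * t) fun t ↦ by
    have h := (hasDerivAt_id t).const_mul (v : ℝ)
    convert! (h.mul h).const_add (v : ℝ) using 1
    simp
    ring
  have h4 := hd (fun t ↦ 3 * v ^ 2 * t + v ^ 3 * t ^ 3) (fun t ↦ 3 * v ^ 2 + 3 * v ^ 3 * t ^ 2)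
    fun t ↦ by
    have ha := (hasDerivAt_id t).const_mul (3 * (v : ℝ) ^ 2)
    have hb := ((hasDerivAt_id t).pow 3).const_mul ((v : ℝ) ^ 3)
    convert! ha.add hb using 1
    simp
    ring
  have h4' : (fun t : ℝ ↦ (2 * v ^ 2 * t + v * t * (v + v * t * (v * t))) *
      Real.exp (v * t ^ 2 / 2)) =
      fun t : ℝ ↦ (3 * v ^ 2 * t + v ^ 3 * t ^ 3) * Real.exp (v * t ^ 2 / 2) := by
    ext t
    ring
  have e2 : deriv (deriv (mgf id (gaussianReal 0 v))) =
      fun t : ℝ ↦ (v + v * t * (v * t)) * Real.exp (v * t ^ 2 / 2) := by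
    rw [h0, h1]
    simpa using h2
  simp only [iteratedDeriv_succ, iteratedDeriv_zero]
  rw [e2, h3, h4', h4]
  simp

theorem integral_pow_gaussianReal_zero (v : ℝ≥0) (k : ℕ) :
    ∫ x, x ^ k ∂gaussianReal 0 v = iteratedDeriv k (mgf id (gaussianReal 0 v)) 0 := by
  rw [iteratedDeriv_mgf_zero (by simp)]
  simp

theorem integral_sq_gaussianReal_zero (v : ℝ≥0) : ∫ x, x ^ 2 ∂gaussianReal 0 v = v := by
  rw [integral_pow_gaussianReal_zero, (iteratedDeriv_mgf_id_gaussianReal v).1]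

theorem integral_pow_four_gaussianReal_zero (v : ℝ≥0) :
    ∫ x, x ^ 4 ∂gaussianReal 0 v = 3 * (v : ℝ) ^ 2 := by
  rw [integral_pow_gaussianReal_zero, (iteratedDeriv_mgf_id_gaussianReal v).2]

theorem integrable_pow_gaussianReal (v : ℝ≥0) (k : ℕ) :
    Integrable (fun x ↦ x ^ k) (gaussianReal 0 v) :=
  integrable_pow_of_mem_interior_integrableExpSet (X := id) (by simp) k

theorem memLp_sq_gaussianReal (v : ℝ≥0) : MemLp (fun x ↦ x ^ 2) 2 (gaussianReal 0 v) := by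
  rw [memLp_two_iff_integrable_sq (by fun_prop)]
  simpa [← pow_mul] using integrable_pow_gaussianReal v 4

theorem variance_sq_gaussianReal (v : ℝ≥0) :
    Var[fun x ↦ x ^ 2; gaussianReal 0 v] = 2 * (v : ℝ) ^ 2 := by
  rw [variance_eq_sub (memLp_sq_gaussianReal v)]
  simp only [Pi.pow_apply, ← pow_mul, Nat.reduceMul]
  rw [integral_pow_four_gaussianReal_zero, integral_sq_gaussianReal_zero]
  ring

/-- The characteristic function of `(G² - 1) / √2` for `G` standard Gaussian, that is, of the
chi-square law with one degree of freedom after centring and scaling to unit variance. -/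
noncomputable def charFunChiSq : ℝ → ℂ :=
  charFun ((gaussianReal 0 1).map fun x ↦ (√2)⁻¹ * (x ^ 2 - 1))

theorem norm_charFunChiSq_le_one (s : ℝ) : ‖charFunChiSq s‖ ≤ 1 := by
  have : IsProbabilityMeasure ((gaussianReal 0 1).map fun x : ℝ ↦ (√2)⁻¹ * (x ^ 2 - 1)) :=
    Measure.isProbabilityMeasure_map (by fun_prop)
  exact norm_charFun_le_one s

/-- The second-order Taylor expansion at `0`; it holds because `(G² - 1) / √2` is centred with
unit variance. -/
theorem charFunChiSq_isLittleO :
    (fun s : ℝ ↦ charFunChiSq s - (1 - s ^ 2 / 2)) =o[𝓝 0] fun s : ℝ ↦ s ^ 2 := by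
  have h2 : ∫ x, x ^ 2 ∂gaussianReal 0 1 = 1 := by
    simpa using integral_sq_gaussianReal_zero 1
  have h4 : ∫ x, x ^ 4 ∂gaussianReal 0 1 = 3 := by
    simpa using integral_pow_four_gaussianReal_zero 1
  refine taylor_charFun_two (by fun_prop) ?_ ?_
  · rw [integral_const_mul, integral_sub (integrable_pow_gaussianReal 1 2) (integrable_const _), h2]
    simp
  · have : (fun x : ℝ ↦ (√2)⁻¹ * (x ^ 2 - 1)) ^ 2 =
        fun x ↦ 2⁻¹ * (x ^ 4 - 2 * x ^ 2 + 1) := by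
      ext x
      simp only [Pi.pow_apply, mul_pow, inv_pow, Real.sq_sqrt zero_le_two]
      ring
    have i2 := integrable_pow_gaussianReal 1 2
    have i4 := integrable_pow_gaussianReal 1 4
    have i42 : Integrable (fun x : ℝ ↦ x ^ 4 - 2 * x ^ 2) (gaussianReal 0 1) :=
      i4.sub (i2.const_mul 2)
    rw [this, integral_const_mul, integral_add i42 (integrable_const _),
      integral_sub i4 (i2.const_mul 2), integral_const_mul, h2, h4, integral_const]
    norm_num

/-- A centred Gaussian `Z` of variance `l` has the law of `√l * G`, so that `Z² - l` has the law of
`√2 * l` times the normalized chi-square variable. -/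
theorem charFun_map_mul_sq_sub {Ω : Type*} [MeasurableSpace Ω] {P : Measure Ω} {Z : Ω → ℝ}
    {l : ℝ≥0} (hZ : HasLaw Z (gaussianReal 0 l) P) (c t : ℝ) :
    charFun (P.map fun ω ↦ c * (Z ω ^ 2 - l)) t = charFunChiSq (√2 * c * l * t) := by
  have h1 : P.map (fun ω ↦ c * (Z ω ^ 2 - l)) =
      (gaussianReal 0 l).map fun x ↦ c * (x ^ 2 - l) := by
    rw [← hZ.map_eq, AEMeasurable.map_map_of_aemeasurable (by fun_prop) hZ.aemeasurable]
    rfl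
  have h2 : gaussianReal 0 l = (gaussianReal 0 1).map fun x ↦ √(l : ℝ) * x := by
    rw [gaussianReal_map_const_mul]
    congr 1
    · simp
    · ext; simp
  rw [h1, h2, Measure.map_map (by fun_prop) (by fun_prop), charFunChiSq,
    ← charFun_map_mul_comp (by fun_prop)]
  congr 2
  ext x
  have : √2 ≠ 0 := by positivity
  simp only [Function.comp_apply, mul_pow]
  rw [Real.sq_sqrt l.coe_nonneg]
  field_simp

theorem memLp_sq_of_hasLaw_gaussianReal {Ω : Type*} [MeasurableSpace Ω] {P : Measure Ω}
    {Z : Ω → ℝ} {l : ℝ≥0} (hZ : HasLaw Z (gaussianReal 0 l) P) :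
    MemLp (fun ω ↦ Z ω ^ 2) 2 P :=
  MemLp.comp_of_map (g := fun x : ℝ ↦ x ^ 2) (hZ.map_eq ▸ memLp_sq_gaussianReal l) hZ.aemeasurable

theorem variance_sum_sq_of_iIndepFun {ι Ω : Type*} [Fintype ι] [MeasurableSpace Ω] {P : Measure Ω}
    {l : ι → ℝ≥0} {Z : ι → Ω → ℝ} (hind : iIndepFun Z P)
    (hlaw : ∀ i, HasLaw (Z i) (gaussianReal 0 (l i)) P) :
    Var[fun ω ↦ ∑ i, Z i ω ^ 2; P] = 2 * ∑ i, (l i : ℝ) ^ 2 := by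
  have h := IndepFun.variance_sum (X := fun i ω ↦ Z i ω ^ 2) (s := Finset.univ)
    (fun i _ ↦ memLp_sq_of_hasLaw_gaussianReal (hlaw i)) fun i _ j _ hij ↦
      (hind.indepFun hij).comp (φ := fun x ↦ x ^ 2) (ψ := fun x ↦ x ^ 2)
        (by fun_prop) (by fun_prop)
  have e : (fun ω ↦ ∑ i, Z i ω ^ 2) = ∑ i, fun ω ↦ Z i ω ^ 2 := by ext ω; simp
  rw [e, h, Finset.mul_sum]
  refine Finset.sum_congr rfl fun i _ ↦ ?_
  rw [← variance_sq_gaussianReal, ← (hlaw i).map_eq,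
    variance_map (by fun_prop) (hlaw i).aemeasurable]
  rfl

theorem integral_sum_sq_of_hasLaw {ι Ω : Type*} [Fintype ι] [MeasurableSpace Ω] {P : Measure Ω}
    [IsFiniteMeasure P] {l : ι → ℝ≥0} {Z : ι → Ω → ℝ}
    (hlaw : ∀ i, HasLaw (Z i) (gaussianReal 0 (l i)) P) :
    ∫ ω, ∑ i, Z i ω ^ 2 ∂P = ∑ i, (l i : ℝ) := by
  rw [integral_finsetSum _ fun i _ ↦
    (memLp_sq_of_hasLaw_gaussianReal (hlaw i)).integrable one_le_two]
  refine Finset.sum_congr rfl fun i _ ↦ ?_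
  rw [← integral_sq_gaussianReal_zero, ← (hlaw i).map_eq,
    integral_map (hlaw i).aemeasurable (by fun_prop)]

/-! ### Central limit theorem for triangular arrays of Gaussian squares -/

theorem norm_prod_sub_prod_le_sum {ι : Type*} (s : Finset ι) {f g : ι → ℂ}
    (hf : ∀ i, ‖f i‖ ≤ 1) (hg : ∀ i, ‖g i‖ ≤ 1) :
    ‖∏ i ∈ s, f i - ∏ i ∈ s, g i‖ ≤ ∑ i ∈ s, ‖f i - g i‖ := by
  classical
  induction s using Finset.induction_on with
  | empty => simp
  | insert a s ha ih =>
    rw [Finset.prod_insert ha, Finset.prod_insert ha, Finset.sum_insert ha]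
    have hgs : ‖∏ i ∈ s, g i‖ ≤ 1 := by
      rw [norm_prod]
      exact Finset.prod_le_one (fun i _ ↦ norm_nonneg _) fun i _ ↦ hg i
    calc _ = ‖(f a - g a) * ∏ i ∈ s, g i + f a * (∏ i ∈ s, f i - ∏ i ∈ s, g i)‖ := by
          congr 1; ring
      _ ≤ ‖f a - g a‖ * ‖∏ i ∈ s, g i‖ + ‖f a‖ * ‖∏ i ∈ s, f i - ∏ i ∈ s, g i‖ := by
          rw [← norm_mul, ← norm_mul]; exact norm_add_le _ _
      _ ≤ ‖f a - g a‖ * 1 + 1 * ∑ i ∈ s, ‖f i - g i‖ := by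
          gcongr
          exact hf a
      _ = _ := by ring

/-- The analytic core of the central limit theorem for triangular arrays: if `ψ` has the Taylor
expansion `1 - s² / 2 + o(s²)` of a standardized characteristic function, and the arguments `s N i`
are uniformly small with `∑ i, s N i ^ 2 → τ`, then `∏ i, ψ (s N i) → exp (-τ / 2)`. The product is
compared factor by factor with the one for the standard Gaussian characteristic function, which has
the same expansion and for which the product is explicit. -/
theorem tendsto_prod_exp_of_isLittleO {ψ : ℝ → ℂ} (hψ : ∀ s, ‖ψ s‖ ≤ 1)
    (ho : (fun s : ℝ ↦ ψ s - (1 - s ^ 2 / 2)) =o[𝓝 0] fun s : ℝ ↦ s ^ 2)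
    {ι : ℕ → Type*} [∀ N, Fintype (ι N)] {s : ∀ N, ι N → ℝ} {δ : ℕ → ℝ} {τ : ℝ}
    (hδ : Tendsto δ atTop (𝓝 0)) (hs : ∀ N i, |s N i| ≤ δ N)
    (hτ : Tendsto (fun N ↦ ∑ i, s N i ^ 2) atTop (𝓝 τ)) :
    Tendsto (fun N ↦ ∏ i, ψ (s N i)) atTop (𝓝 (Complex.exp (-τ / 2))) := by
  let g : ℝ → ℂ := charFun (gaussianReal 0 1)
  have hg_eq s : g s = Complex.exp (-(s ^ 2 : ℝ) / 2) := by
    simp [g, charFun_gaussianReal, neg_div]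
  have hg : (fun s : ℝ ↦ g s - (1 - s ^ 2 / 2)) =o[𝓝 0] fun s : ℝ ↦ s ^ 2 := by
    have h := taylor_charFun_two (P := gaussianReal 0 1) (X := id) (by fun_prop) (by simp) (by
      simpa using integral_sq_gaussianReal_zero 1)
    rwa [Measure.map_id] at h
  have hd : (fun s : ℝ ↦ ψ s - g s) =o[𝓝 0] fun s : ℝ ↦ s ^ 2 := by
    simpa using ho.sub hg
  have hlim : Tendsto (fun N ↦ ∏ i, g (s N i)) atTop (𝓝 (Complex.exp (-τ / 2))) := by
    have h1 : ∀ N, ∏ i, g (s N i) = Complex.exp (-((∑ i, s N i ^ 2 : ℝ) : ℂ) / 2) := fun N ↦ by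
      simp only [hg_eq, ← Complex.exp_sum, ← Finset.sum_div]
      simp
    simp only [h1]
    exact (Complex.continuous_exp.tendsto _).comp
      (((Complex.continuous_ofReal.tendsto _).comp hτ).neg.div_const 2)
  refine tendsto_of_tendsto_of_dist hlim ?_
  rw [Metric.tendsto_atTop]
  intro ε hε
  have hτ0 : 0 < |τ| + 1 := by positivity
  have hη : 0 < ε / (|τ| + 1) / 2 := by positivity
  obtain ⟨ρ, hρ, hball⟩ := Metric.eventually_nhds_iff.1 (hd.def hη)
  have e1 : ∀ᶠ N in atTop, δ N < ρ := hδ.eventually_lt_const hρ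
  have e2 : ∀ᶠ N in atTop, ∑ i, s N i ^ 2 < |τ| + 1 :=
    hτ.eventually_lt_const (by linarith [le_abs_self τ])
  obtain ⟨N₀, hN₀⟩ := eventually_atTop.1 (e1.and e2)
  refine ⟨N₀, fun N hN ↦ ?_⟩
  obtain ⟨h1, h2⟩ := hN₀ N hN
  rw [Real.dist_0_eq_abs, abs_of_nonneg dist_nonneg, dist_comm, dist_eq_norm]
  calc ‖∏ i, ψ (s N i) - ∏ i, g (s N i)‖ ≤ ∑ i, ‖ψ (s N i) - g (s N i)‖ :=
        norm_prod_sub_prod_le_sum _ (fun i ↦ hψ _) fun i ↦ norm_charFun_le_one _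
    _ ≤ ∑ i, ε / (|τ| + 1) / 2 * s N i ^ 2 := by
        refine Finset.sum_le_sum fun i _ ↦ ?_
        have := hball (y := s N i) (by simpa using (hs N i).trans_lt h1)
        simpa using this
    _ = ε / (|τ| + 1) / 2 * ∑ i, s N i ^ 2 := by rw [Finset.mul_sum]
    _ ≤ ε / (|τ| + 1) / 2 * (|τ| + 1) := by gcongr
    _ = ε / 2 := by field_simp
    _ < ε := half_lt_self hε

/-- Central limit theorem, in terms of characteristic functions, for row sums of centred squares of
independent Gaussians with bounded variances `l N i`, when `(∑ i, l N i ^ 2) / N` converges. -/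
theorem tendsto_charFun_sum_sq_sub {Ω : Type*} [MeasurableSpace Ω] {P : Measure Ω}
    {ι : ℕ → Type*} [∀ N, Fintype (ι N)] {l : ∀ N, ι N → ℝ≥0} {Z : ∀ N, ι N → Ω → ℝ}
    (hind : ∀ N, iIndepFun (Z N) P) (hlaw : ∀ N i, HasLaw (Z N i) (gaussianReal 0 (l N i)) P)
    {M τ : ℝ} (hM : ∀ N i, (l N i : ℝ) ≤ M)
    (hτ : Tendsto (fun N : ℕ ↦ (∑ i, (l N i : ℝ) ^ 2) / (N : ℝ)) atTop (𝓝 τ)) (a t : ℝ) :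
    Tendsto (fun N : ℕ ↦
      charFun (P.map fun ω ↦ (√(N : ℝ))⁻¹ * (a * ∑ i, (Z N i ω ^ 2 - l N i))) t) atTop
      (𝓝 (Complex.exp (-(2 * a ^ 2 * τ * t ^ 2 : ℝ) / 2))) := by
  have h1 : ∀ N : ℕ,
      charFun (P.map fun ω ↦ (√(N : ℝ))⁻¹ * (a * ∑ i, (Z N i ω ^ 2 - l N i))) t =
        ∏ i, charFunChiSq (√2 * ((√(N : ℝ))⁻¹ * a) * l N i * t) := fun N ↦ by
    have hm i : AEMeasurable (Z N i) P := (hlaw N i).aemeasurable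
    have e : (fun ω ↦ (√(N : ℝ))⁻¹ * (a * ∑ i, (Z N i ω ^ 2 - l N i))) =
        fun ω ↦ ∑ i, (√(N : ℝ))⁻¹ * a * (Z N i ω ^ 2 - l N i) := by
      ext ω
      rw [← mul_assoc, Finset.mul_sum]
    have hc : iIndepFun (fun i ω ↦ (√(N : ℝ))⁻¹ * a * (Z N i ω ^ 2 - l N i)) P :=
      (hind N).comp (fun i x ↦ (√(N : ℝ))⁻¹ * a * (x ^ 2 - l N i)) fun i ↦ by fun_prop
    rw [e, hc.charFun_map_fun_sum_eq_prod fun i ↦ by fun_prop, Finset.prod_apply]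
    exact Finset.prod_congr rfl fun i _ ↦ charFun_map_mul_sq_sub (hlaw N i) _ _
  simp only [h1]
  refine tendsto_prod_exp_of_isLittleO (δ := fun N ↦ √2 * |a| * M * |t| * (√(N : ℝ))⁻¹)
    norm_charFunChiSq_le_one charFunChiSq_isLittleO ?_ ?_ ?_
  · have : Tendsto (fun N : ℕ ↦ (√(N : ℝ))⁻¹) atTop (𝓝 0) :=
      tendsto_inv_atTop_zero.comp (Real.tendsto_sqrt_atTop.comp tendsto_natCast_atTop_atTop)
    simpa using this.const_mul (√2 * |a| * M * |t|)
  · intro N i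
    have hl : |(l N i : ℝ)| ≤ M := by rw [abs_of_nonneg (l N i).coe_nonneg]; exact hM N i
    simp only [abs_mul, abs_inv, abs_of_nonneg (Real.sqrt_nonneg _)]
    calc _ = √2 * |a| * |(l N i : ℝ)| * |t| * (√(N : ℝ))⁻¹ := by ring
      _ ≤ _ := by gcongr
  · refine (hτ.const_mul (2 * a ^ 2 * t ^ 2)).congr' ?_ |>.trans_eq ?_
    · refine Eventually.of_forall fun N ↦ ?_
      simp only [mul_pow, inv_pow, Real.sq_sqrt zero_le_two, Real.sq_sqrt (Nat.cast_nonneg N)]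
      rw [div_eq_mul_inv, Finset.sum_mul, Finset.mul_sum]
      exact Finset.sum_congr rfl fun i _ ↦ by ring
    · congr 1; ring

/-! ### Sums of powers of distances -/

/-- The row sums of the matrix `r ^ |k - j|` are bounded uniformly in its size. -/
theorem sum_pow_dist_le {r : ℝ} (hr0 : 0 ≤ r) (hr1 : r < 1) {N k : ℕ} (hk : k < N) :
    ∑ j ∈ Finset.range N, r ^ Nat.dist k j ≤ 2 / (1 - r) := by
  have hgeom : ∀ m : ℕ, ∑ i ∈ Finset.range m, r ^ i ≤ 1 / (1 - r) := fun m ↦ by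
    rw [one_div, ← tsum_geometric_of_lt_one hr0 hr1]
    exact (summable_geometric_of_lt_one hr0 hr1).sum_le_tsum _ fun i _ ↦ pow_nonneg hr0 i
  obtain ⟨m, rfl⟩ := Nat.exists_eq_add_of_lt hk
  rw [add_assoc, Finset.sum_range_add]
  have h1 : ∑ j ∈ Finset.range k, r ^ Nat.dist k j ≤ 1 / (1 - r) := by
    refine le_trans ?_ (hgeom k)
    rw [← Finset.sum_range_reflect]
    refine Finset.sum_le_sum fun j hj ↦ ?_
    rw [Finset.mem_range] at hj
    exact pow_le_pow_of_le_one hr0 hr1.le (by rw [Nat.dist]; omega)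
  have h2 : ∑ j ∈ Finset.range (m + 1), r ^ Nat.dist k (k + j) ≤ 1 / (1 - r) := by
    simpa [Nat.dist] using hgeom (m + 1)
  calc _ ≤ 1 / (1 - r) + 1 / (1 - r) := add_le_add h1 h2
    _ = _ := by ring

/-- Bordering the matrix `q ^ |i - j|` of size `m` by one row and one column adds
`1 + 2 * (q + ⋯ + q ^ m)` to the sum of its entries. -/
theorem sum_sum_pow_dist (q : ℝ) (N : ℕ) :
    ∑ i ∈ Finset.range N, ∑ j ∈ Finset.range N, q ^ Nat.dist i j =
      ∑ m ∈ Finset.range N, (1 + 2 * q * ∑ i ∈ Finset.range m, q ^ i) := by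
  induction N with
  | zero => simp
  | succ N ih =>
    have h : ∑ i ∈ Finset.range N, q ^ Nat.dist i N = q * ∑ i ∈ Finset.range N, q ^ i := by
      rw [← Finset.sum_range_reflect, Finset.mul_sum]
      refine Finset.sum_congr rfl fun j hj ↦ ?_
      rw [Finset.mem_range] at hj
      rw [← pow_succ']
      congr 1
      rw [Nat.dist]
      omega
    rw [Finset.sum_range_succ]
    simp only [Finset.sum_range_succ _ N]
    rw [Finset.sum_add_distrib, ih, h]
    simp only [Nat.dist_comm N]
    rw [h]
    simp
    ring

/-- By `sum_sum_pow_dist` the left side is a Cesàro mean of the partial sums of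
`1 + 2 * ∑ t ≥ 1, q ^ t = (1 + q) / (1 - q)`. -/
theorem tendsto_sum_sum_pow_dist {q : ℝ} (hq0 : 0 ≤ q) (hq1 : q < 1) :
    Tendsto (fun N : ℕ ↦
      (∑ i ∈ Finset.range N, ∑ j ∈ Finset.range N, q ^ Nat.dist i j) / (N : ℝ)) atTop
      (𝓝 ((1 + q) / (1 - q))) := by
  have h := ((hasSum_geometric_of_lt_one hq0 hq1).tendsto_sum_nat.const_mul (2 * q)).const_add 1
  have hq : 1 - q ≠ 0 := by linarith
  rw [show 1 + 2 * q * (1 - q)⁻¹ = (1 + q) / (1 - q) by field_simp; ring] at h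
  refine h.cesaro.congr fun N ↦ ?_
  rw [sum_sum_pow_dist, inv_mul_eq_div]

/-- For a centred Gaussian sequence with covariances `s * r ^ |i - j|`, the partial sums of squares
are row sums of squares of independent Gaussians whose variances satisfy the hypotheses of
`tendsto_charFun_sum_sq_sub`. -/
theorem exists_sum_sq_representation {Ω : Type*} [MeasurableSpace Ω] {P : Measure Ω}
    {Y : ℕ → Ω → ℝ} {s r : ℝ} (hs : 0 ≤ s) (hr0 : 0 ≤ r) (hr1 : r < 1)
    (hY : ∀ N, HasGaussianLaw (fun ω (i : Fin N) ↦ Y i ω) P)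
    (hmean : ∀ k, ∫ ω, Y k ω ∂P = 0) (hcov : ∀ i j, cov[Y i, Y j; P] = s * r ^ Nat.dist i j) :
    ∃ (l : ∀ N, Fin N → ℝ≥0) (Z : ∀ N, Fin N → Ω → ℝ), (∀ N, iIndepFun (Z N) P) ∧
      (∀ N i, HasLaw (Z N i) (gaussianReal 0 (l N i)) P) ∧
      (∀ N ω, ∑ k ∈ Finset.range N, Y k ω ^ 2 = ∑ i, Z N i ω ^ 2) ∧
      (∀ N, ∑ i, (l N i : ℝ) = N * s) ∧
      (∀ N i, (l N i : ℝ) ≤ s * (2 / (1 - r))) ∧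
      Tendsto (fun N : ℕ ↦ (∑ i, (l N i : ℝ) ^ 2) / (N : ℝ)) atTop
        (𝓝 (s ^ 2 * ((1 + r ^ 2) / (1 - r ^ 2)))) := by
  choose l Z hind hlaw hsq hsum hsum2 hmax using fun N ↦
    (hY N).exists_diagonalization fun i ↦ hmean i
  refine ⟨l, Z, hind, hlaw, fun N ω ↦ ?_, fun N ↦ ?_, fun N i ↦ ?_, ?_⟩
  · rw [← hsq, Fin.sum_univ_eq_sum_range fun k ↦ Y k ω ^ 2]
  · rw [hsum]; simp [hcov]
  · obtain ⟨k, hk⟩ := hmax N i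
    refine hk.trans ?_
    simp only [hcov, abs_of_nonneg (mul_nonneg hs (pow_nonneg hr0 _))]
    rw [← Finset.mul_sum, Fin.sum_univ_eq_sum_range fun j ↦ r ^ Nat.dist k j]
    gcongr
    exact sum_pow_dist_le hr0 hr1 k.2
  · refine ((tendsto_sum_sum_pow_dist (sq_nonneg r)
      (pow_lt_one₀ hr0 hr1 two_ne_zero)).const_mul (s ^ 2)).congr fun N ↦ ?_
    rw [hsum2, ← mul_div_assoc]
    simp only [hcov]
    rw [Fin.sum_univ_eq_sum_range fun i ↦ ∑ j : Fin N, (s * r ^ Nat.dist i j) ^ 2]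
    congr 1
    rw [Finset.mul_sum]
    refine Finset.sum_congr rfl fun i _ ↦ ?_
    rw [Fin.sum_univ_eq_sum_range fun j ↦ (s * r ^ Nat.dist i j) ^ 2, Finset.mul_sum]
    exact Finset.sum_congr rfl fun j _ ↦ by rw [mul_pow, ← pow_mul, ← pow_mul, mul_comm 2]

/-! ### Linear forms in Gaussian vectors -/

section
variable {n : ℕ} {Ω : Type*} [MeasurableSpace Ω] {P : Measure Ω}
  {ξ : Ω → EuclideanSpace ℝ (Fin n)} {S : Matrix (Fin n) (Fin n) ℝ}

theorem inner_toLp_eq_dotProduct (c : Fin n → ℝ) (z : EuclideanSpace ℝ (Fin n)) :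
    inner ℝ (WithLp.toLp 2 c) z = c ⬝ᵥ z.ofLp := by
  simp [PiLp.inner_apply, dotProduct, mul_comm]

theorem measurable_dotProduct_ofLp (c : Fin n → ℝ) :
    Measurable fun z : EuclideanSpace ℝ (Fin n) ↦ c ⬝ᵥ z.ofLp := by
  unfold dotProduct
  fun_prop

theorem ProbabilityTheory.HasGaussianLaw.memLp_dotProduct (hξ : HasGaussianLaw ξ P)
    (c : Fin n → ℝ) : MemLp (fun ω ↦ c ⬝ᵥ (ξ ω).ofLp) 2 P := by
  have h := (hξ.map_fun (innerSL ℝ (WithLp.toLp 2 c))).memLp_two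
  simpa only [innerSL_apply_apply, inner_toLp_eq_dotProduct] using h

theorem ProbabilityTheory.HasLaw.integral_dotProduct
    (hξ : HasLaw ξ (multivariateGaussian 0 S) P) (c : Fin n → ℝ) :
    ∫ ω, c ⬝ᵥ (ξ ω).ofLp ∂P = 0 := by
  have h := (innerSL ℝ (WithLp.toLp 2 c)).integral_comp_comm hξ.hasGaussianLaw.integrable
  rw [hξ.integral_eq, integral_id_multivariateGaussian, map_zero] at h
  simpa only [innerSL_apply_apply, inner_toLp_eq_dotProduct] using h

theorem ProbabilityTheory.HasLaw.variance_dotProduct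
    (hξ : HasLaw ξ (multivariateGaussian 0 S) P) (hS : S.PosSemidef) (c : Fin n → ℝ) :
    Var[fun ω ↦ c ⬝ᵥ (ξ ω).ofLp; P] = c ⬝ᵥ (S *ᵥ c) := by
  have h := covarianceBilin_multivariateGaussian (μ := 0) hS (WithLp.toLp 2 c) (WithLp.toLp 2 c)
  rw [covarianceBilin_self IsGaussian.memLp_two_id, ← hξ.map_eq,
    variance_map (by fun_prop) hξ.aemeasurable] at h
  simpa only [Function.comp_def, inner_toLp_eq_dotProduct] using h
end

/-! ### Gaussian systems in steady state -/

namespace LinearGaussianSystem.IsSteadyStateRun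

variable {n : ℕ} {sys : LinearGaussianSystem n} {S : Matrix (Fin n) (Fin n) ℝ}
  {Ω : Type*} [MeasurableSpace Ω] {P : Measure Ω}
  {x w : ℕ → Ω → EuclideanSpace ℝ (Fin n)} {v y : ℕ → Ω → ℝ}

theorem dotProduct_state_succ (h : sys.IsSteadyStateRun S P x w v y) (c : Fin n → ℝ) (k : ℕ)
    (ω : Ω) : c ⬝ᵥ (x (k + 1) ω).ofLp =
      (c ᵥ* sys.A) ⬝ᵥ (x k ω).ofLp + c ⬝ᵥ (w k ω).ofLp := by
  rw [h.state_eq, WithLp.ofLp_add, dotProduct_add, Matrix.dotProduct_mulVec]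

theorem memLp_noise (h : sys.IsSteadyStateRun S P x w v y) (c : Fin n → ℝ) (k : ℕ) :
    MemLp (fun ω ↦ c ⬝ᵥ (w k ω).ofLp) 2 P :=
  (h.law_w k).hasGaussianLaw.memLp_dotProduct c

theorem memLp_state (h : sys.IsSteadyStateRun S P x w v y) (c : Fin n → ℝ) (k : ℕ) :
    MemLp (fun ω ↦ c ⬝ᵥ (x k ω).ofLp) 2 P := by
  induction k generalizing c with
  | zero => exact h.law_init.hasGaussianLaw.memLp_dotProduct c
  | succ k ih =>
    simp only [h.dotProduct_state_succ]
    exact (ih _).add (h.memLp_noise c k)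

theorem memLp_obsNoise (h : sys.IsSteadyStateRun S P x w v y) (k : ℕ) : MemLp (v k) 2 P :=
  (h.law_v k).hasGaussianLaw.memLp_two

theorem integral_state [IsProbabilityMeasure P]
    (h : sys.IsSteadyStateRun S P x w v y) (c : Fin n → ℝ) (k : ℕ) :
    ∫ ω, c ⬝ᵥ (x k ω).ofLp ∂P = 0 := by
  induction k generalizing c with
  | zero => exact h.law_init.integral_dotProduct c
  | succ k ih =>
    simp only [h.dotProduct_state_succ]
    rw [integral_add ((h.memLp_state _ k).integrable one_le_two)
      ((h.memLp_noise c k).integrable one_le_two), ih, (h.law_w k).integral_dotProduct, add_zero]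

/-- Present and future process noise is uncorrelated with the present state. -/
theorem covariance_state_noise [IsProbabilityMeasure P]
    (h : sys.IsSteadyStateRun S P x w v y) (c d : Fin n → ℝ)
    {k m : ℕ} (hkm : k ≤ m) :
    cov[fun ω ↦ c ⬝ᵥ (x k ω).ofLp, fun ω ↦ d ⬝ᵥ (w m ω).ofLp; P] = 0 := by
  induction k generalizing c with
  | zero =>
    refine IndepFun.covariance_eq_zero ?_ (h.memLp_state c 0) (h.memLp_noise d m)
    exact h.indep_init.comp (measurable_dotProduct_ofLp c)
      ((measurable_dotProduct_ofLp d).comp ((measurable_pi_apply m).comp measurable_fst))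
  | succ k ih =>
    have hX := h.memLp_state (c ᵥ* sys.A) k
    have hW := h.memLp_noise c k
    have hD := h.memLp_noise d m
    have e : (fun ω ↦ c ⬝ᵥ (x (k + 1) ω).ofLp) = (fun ω ↦ (c ᵥ* sys.A) ⬝ᵥ (x k ω).ofLp) +
        fun ω ↦ c ⬝ᵥ (w k ω).ofLp := funext fun ω ↦ h.dotProduct_state_succ c k ω
    have hi : IndepFun (fun ω ↦ c ⬝ᵥ (w k ω).ofLp) (fun ω ↦ d ⬝ᵥ (w m ω).ofLp) P :=
      (h.indep_w.indepFun (by omega : k ≠ m)).comp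
        (measurable_dotProduct_ofLp c) (measurable_dotProduct_ofLp d)
    rw [e, covariance_add_left hX hW hD, ih _ (by omega), hi.covariance_eq_zero hW hD, add_zero]

theorem covariance_state_obsNoise [IsProbabilityMeasure P]
    (h : sys.IsSteadyStateRun S P x w v y) (c : Fin n → ℝ)
    (k m : ℕ) : cov[fun ω ↦ c ⬝ᵥ (x k ω).ofLp, v m; P] = 0 := by
  induction k generalizing c with
  | zero =>
    refine IndepFun.covariance_eq_zero ?_ (h.memLp_state c 0) (h.memLp_obsNoise m)
    exact h.indep_init.comp (measurable_dotProduct_ofLp c)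
      ((measurable_pi_apply m).comp measurable_snd)
  | succ k ih =>
    have hX := h.memLp_state (c ᵥ* sys.A) k
    have hW := h.memLp_noise c k
    have hV := h.memLp_obsNoise m
    have e : (fun ω ↦ c ⬝ᵥ (x (k + 1) ω).ofLp) = (fun ω ↦ (c ᵥ* sys.A) ⬝ᵥ (x k ω).ofLp) +
        fun ω ↦ c ⬝ᵥ (w k ω).ofLp := funext fun ω ↦ h.dotProduct_state_succ c k ω
    have hi : IndepFun (fun ω ↦ c ⬝ᵥ (w k ω).ofLp) (v m) P :=
      h.indep_noises.comp ((measurable_dotProduct_ofLp c).comp (measurable_pi_apply k))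
        (measurable_pi_apply m)
    rw [e, covariance_add_left hX hW hV, ih, hi.covariance_eq_zero hW hV, add_zero]

/-- The state covariance stays equal to `S`, by the Lyapunov equation. -/
theorem variance_state [IsProbabilityMeasure P]
    (h : sys.IsSteadyStateRun S P x w v y) (c : Fin n → ℝ) (k : ℕ) :
    Var[fun ω ↦ c ⬝ᵥ (x k ω).ofLp; P] = c ⬝ᵥ (S *ᵥ c) := by
  induction k generalizing c with
  | zero => exact h.law_init.variance_dotProduct h.cov.posSemidef c
  | succ k ih =>
    simp only [h.dotProduct_state_succ]
    rw [variance_fun_add (h.memLp_state _ k) (h.memLp_noise c k), ih,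
      h.covariance_state_noise _ _ le_rfl, (h.law_w k).variance_dotProduct sys.Q_posSemidef]
    conv_rhs => rw [h.cov.lyapunov]
    rw [Matrix.add_mulVec, dotProduct_add, ← Matrix.mulVec_mulVec, ← Matrix.mulVec_mulVec,
      Matrix.mulVec_transpose, Matrix.dotProduct_mulVec c sys.A]
    ring

theorem output_eq_fun (h : sys.IsSteadyStateRun S P x w v y) (k : ℕ) :
    y k = fun ω ↦ sys.C ⬝ᵥ (x k ω).ofLp + v k ω :=
  funext (h.output_eq k)

theorem integral_output [IsProbabilityMeasure P]
    (h : sys.IsSteadyStateRun S P x w v y) (k : ℕ) :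
    ∫ ω, y k ω ∂P = 0 := by
  rw [h.output_eq_fun, integral_add ((h.memLp_state _ k).integrable one_le_two)
    ((h.memLp_obsNoise k).integrable one_le_two), h.integral_state, (h.law_v k).integral_eq,
    integral_id_gaussianReal, add_zero]

theorem variance_output [IsProbabilityMeasure P]
    (h : sys.IsSteadyStateRun S P x w v y) (k : ℕ) :
    Var[y k; P] = sys.outputVar S := by
  rw [h.output_eq_fun, variance_fun_add (h.memLp_state _ k) (h.memLp_obsNoise k),
    h.variance_state, h.covariance_state_obsNoise, (h.law_v k).variance_eq,
    variance_id_gaussianReal, outputVar]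
  ring

/-- The outputs are jointly Gaussian, being linear images of the independent Gaussian vectors `x 0`,
`(w 0, …, w (N - 1))` and `(v 0, …, v (N - 1))`. -/
theorem hasGaussianLaw_output (h : sys.IsSteadyStateRun S P x w v y) (N : ℕ) :
    HasGaussianLaw (fun ω (i : Fin N) ↦ y i ω) P := by
  let E := EuclideanSpace ℝ (Fin n)
  let U : Ω → E × ((Fin N → E) × (Fin N → ℝ)) := fun ω ↦ (x 0 ω, fun i ↦ w i ω, fun i ↦ v i ω)
  have hU : HasGaussianLaw U P := by
    have hw : HasGaussianLaw (fun ω (i : Fin N) ↦ w i ω) P :=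
      iIndepFun.hasGaussianLaw (fun i ↦ (h.law_w i).hasGaussianLaw)
        (h.indep_w.precomp Fin.val_injective)
    have hv : HasGaussianLaw (fun ω (i : Fin N) ↦ v i ω) P :=
      iIndepFun.hasGaussianLaw (fun i ↦ (h.law_v i).hasGaussianLaw)
        (h.indep_v.precomp Fin.val_injective)
    have hwv : IndepFun (fun ω (i : Fin N) ↦ w i ω) (fun ω (i : Fin N) ↦ v i ω) P :=
      h.indep_noises.comp (φ := fun (f : ℕ → E) (i : Fin N) ↦ f i)
        (ψ := fun (f : ℕ → ℝ) (i : Fin N) ↦ f i) (by fun_prop) (by fun_prop)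
    refine IndepFun.hasGaussianLaw h.law_init.hasGaussianLaw (hwv.hasGaussianLaw hw hv) ?_
    exact h.indep_init.comp (φ := id)
      (ψ := fun (f : (ℕ → E) × (ℕ → ℝ)) ↦ ((fun i : Fin N ↦ f.1 i), fun i : Fin N ↦ f.2 i))
      measurable_id (by fun_prop)
  have hx : ∀ k ≤ N, ∃ L : (E × ((Fin N → E) × (Fin N → ℝ))) →L[ℝ] E, ∀ ω, x k ω = L (U ω) := by
    intro k
    induction k with
    | zero => exact fun _ ↦ ⟨ContinuousLinearMap.fst ℝ _ _, fun ω ↦ rfl⟩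
    | succ k ih =>
      intro hk
      obtain ⟨L, hL⟩ := ih (by omega)
      refine ⟨(Matrix.toEuclideanCLM (𝕜 := ℝ) sys.A).comp L +
        (ContinuousLinearMap.proj (⟨k, hk⟩ : Fin N)).comp
          ((ContinuousLinearMap.fst ℝ (Fin N → E) (Fin N → ℝ)).comp
            (ContinuousLinearMap.snd ℝ _ _)), fun ω ↦ ?_⟩
      rw [h.state_eq, hL]
      rfl
  choose L hL using fun i : Fin N ↦ hx i i.2.le
  let T : (E × ((Fin N → E) × (Fin N → ℝ))) →L[ℝ] (Fin N → ℝ) :=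
    ContinuousLinearMap.pi fun i ↦ (innerSL ℝ (WithLp.toLp 2 sys.C)).comp (L i) +
      (ContinuousLinearMap.proj i).comp
          ((ContinuousLinearMap.snd ℝ (Fin N → E) (Fin N → ℝ)).comp
            (ContinuousLinearMap.snd ℝ _ _))
  have hT : (fun ω (i : Fin N) ↦ y i ω) = fun ω ↦ T (U ω) := by
    ext ω i
    rw [h.output_eq, hL, ← inner_toLp_eq_dotProduct]
    rfl
  rw [hT]
  exact hU.map_fun T

end LinearGaussianSystem.IsSteadyStateRun

theorem LinearGaussianSystem.IsSteadyStateRun.covariance_output {n : ℕ}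
    {sys : LinearGaussianSystem n} {S : Matrix (Fin n) (Fin n) ℝ} {Ω : Type*} [MeasurableSpace Ω]
    {P : Measure Ω} [IsProbabilityMeasure P] {x w : ℕ → Ω → EuclideanSpace ℝ (Fin n)}
    {v y : ℕ → Ω → ℝ} (h : sys.IsSteadyStateRun S P x w v y) {r : ℝ}
    (hcorr : ∀ k t : ℕ, ∫ ω, y k ω * y (k + t) ω ∂P = r ^ t * ∫ ω, y k ω * y k ω ∂P)
    (i j : ℕ) : cov[y i, y j; P] = sys.outputVar S * r ^ Nat.dist i j := by
  have hm (k : ℕ) : MemLp (y k) 2 P := by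
    rw [h.output_eq_fun]
    exact (h.memLp_state _ k).add (h.memLp_obsNoise k)
  have hsq (k : ℕ) : ∫ ω, y k ω * y k ω ∂P = sys.outputVar S := by
    rw [← h.variance_output k, variance_of_integral_eq_zero (hm k).aemeasurable
      (h.integral_output k)]
    simp [sq]
  have hle (k t : ℕ) : cov[y k, y (k + t); P] = sys.outputVar S * r ^ t := by
    rw [covariance_eq_sub (hm k) (hm _), h.integral_output]
    simp only [Pi.mul_apply, hcorr, hsq]
    ring
  rcases le_total i j with hij | hij
  · obtain ⟨t, rfl⟩ := Nat.exists_eq_add_of_le hij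
    rw [hle]; simp [Nat.dist]
  · obtain ⟨t, rfl⟩ := Nat.exists_eq_add_of_le hij
    rw [covariance_comm, hle]; simp [Nat.dist]

/-! ### Log-likelihood ratio -/

/-- The log-likelihood ratio of one measurement is an affine function of its square. -/
theorem log_gaussianPDFReal_div {sα sβ : ℝ≥0} (hα : 0 < sα) (hβ : 0 < sβ) (z : ℝ) :
    Real.log (gaussianPDFReal 0 sα z / gaussianPDFReal 0 sβ z) =
      1 / 2 * Real.log ((sβ : ℝ) / sα) + ((sβ : ℝ)⁻¹ - (sα : ℝ)⁻¹) / 2 * z ^ 2 := by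
  have ha : (0 : ℝ) < sα := hα
  have hb : (0 : ℝ) < sβ := hβ
  have h (s : ℝ≥0) (hs : (0 : ℝ) < s) : Real.log (gaussianPDFReal 0 s z) =
      -(Real.log (2 * Real.pi) + Real.log s) / 2 - z ^ 2 / (2 * s) := by
    rw [gaussianPDFReal, Real.log_mul (by positivity) (by positivity), Real.log_inv,
      Real.log_sqrt (by positivity), Real.log_exp, Real.log_mul (by positivity) hs.ne']
    ring
  rw [Real.log_div (gaussianPDFReal_pos _ _ _ hα.ne').ne' (gaussianPDFReal_pos _ _ _ hβ.ne').ne',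
    h _ ha, h _ hb, Real.log_div hb.ne' ha.ne']
  field_simp
  ring

theorem logLikelihoodRatio_eq {Ω : Type*} {sα sβ : ℝ≥0} (hα : 0 < sα) (hβ : 0 < sβ)
    (y : ℕ → Ω → ℝ) (N : ℕ) (ω : Ω) :
    logLikelihoodRatio sα sβ y N ω = N / 2 * Real.log ((sβ : ℝ) / sα) +
      ((sβ : ℝ)⁻¹ - (sα : ℝ)⁻¹) / 2 * ∑ k ∈ Finset.range N, y k ω ^ 2 := by
  simp only [logLikelihoodRatio, log_gaussianPDFReal_div hα hβ]
  rw [Finset.sum_add_distrib, Finset.sum_const, Finset.card_range, nsmul_eq_mul, ← Finset.mul_sum]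
  ring

theorem lemma3 {n : ℕ} (sys : LinearGaussianSystem n) (S : Matrix (Fin n) (Fin n) ℝ)
    {Ω : Type*} [MeasurableSpace Ω] (P : Measure Ω) [IsProbabilityMeasure P]
    (x w : ℕ → Ω → EuclideanSpace ℝ (Fin n)) (v y : ℕ → Ω → ℝ)
    (hrun : sys.IsSteadyStateRun S P x w v y)
    (r : ℝ) (hr0 : 0 ≤ r) (hr1 : r < 1)
    (hcorr : ∀ k t : ℕ, ∫ ω, y k ω * y (k + t) ω ∂P = r ^ t * ∫ ω, y k ω * y k ω ∂P)
    (sα sβ : ℝ≥0) (hα : 0 < sα) (hβ : 0 < sβ) :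
    -- asymptotic normality on the scale `√N`, also when the limit variance is zero
    TendstoInDistribution
      (fun (N : ℕ) ω ↦ (√(N : ℝ))⁻¹ *
        (logLikelihoodRatio sα sβ y N ω - uncorrMean sα sβ (sys.outputVar S) N))
      atTop (id : ℝ → ℝ) (fun _ ↦ P)
      (gaussianReal 0 (corrVar sα sβ (sys.outputVar S) r 1).toNNReal) ∧
    -- the standardized ratio is asymptotically standard normal in the nondegenerate case
    (sα ≠ sβ → sys.outputVar S ≠ 0 →
      TendstoInDistribution
        (fun (N : ℕ) ω ↦ (√(corrVar sα sβ (sys.outputVar S) r N))⁻¹ *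
          (logLikelihoodRatio sα sβ y N ω - uncorrMean sα sβ (sys.outputVar S) N))
        atTop (id : ℝ → ℝ) (fun _ ↦ P) (gaussianReal 0 1)) ∧
    -- exact mean, and asymptotic growth of the variance
    (∀ N : ℕ, MemLp (logLikelihoodRatio sα sβ y N) 2 P ∧
      ∫ ω, logLikelihoodRatio sα sβ y N ω ∂P = uncorrMean sα sβ (sys.outputVar S) N) ∧
    Tendsto (fun N : ℕ ↦ variance (logLikelihoodRatio sα sβ y N) P / (N : ℝ)) atTop
      (𝓝 (corrVar sα sβ (sys.outputVar S) r 1)) := by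
  set s := sys.outputVar S with hs_def
  have hs : 0 ≤ s := by
    rw [hs_def, ← hrun.variance_output 0]
    exact variance_nonneg _ _
  obtain ⟨l, Z, hind, hlaw, hsq, hsum, hmax, hlim⟩ := exists_sum_sq_representation hs hr0 hr1
    hrun.hasGaussianLaw_output hrun.integral_output (hrun.covariance_output hcorr)
  set c : ℝ := (sβ : ℝ)⁻¹ - (sα : ℝ)⁻¹ with hc
  set τ : ℝ := s ^ 2 * ((1 + r ^ 2) / (1 - r ^ 2)) with hτ
  have hr2 : r ^ 2 < 1 := pow_lt_one₀ hr0 hr1 two_ne_zero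
  have hfac : 0 < (1 + r ^ 2) / (1 - r ^ 2) := div_pos (by positivity) (by linarith)
  have hcv (N : ℕ) : corrVar sα sβ s r N = N * (c ^ 2 / 2 * τ) := by
    rw [corrVar, uncorrVar, hτ]
    ring
  have hcv1 : corrVar sα sβ s r 1 = c ^ 2 / 2 * τ := by simpa using hcv 1
  have hcv0 : 0 ≤ corrVar sα sβ s r 1 := by rw [hcv1]; positivity
  have hL (N : ℕ) : logLikelihoodRatio sα sβ y N =
      fun ω ↦ N / 2 * Real.log ((sβ : ℝ) / sα) + c / 2 * ∑ i, Z N i ω ^ 2 := by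
    ext ω
    rw [logLikelihoodRatio_eq hα hβ, hsq]
  have hD (N : ℕ) (ω : Ω) : logLikelihoodRatio sα sβ y N ω - uncorrMean sα sβ s N =
      c / 2 * ∑ i, (Z N i ω ^ 2 - l N i) := by
    rw [hL, Finset.sum_sub_distrib, hsum, uncorrMean]
    ring
  have hmem (N : ℕ) : MemLp (fun ω ↦ ∑ i, Z N i ω ^ 2) 2 P :=
    memLp_finsetSum _ fun i _ ↦ memLp_sq_of_hasLaw_gaussianReal (hlaw N i)
  have hLmem (N : ℕ) : MemLp (logLikelihoodRatio sα sβ y N) 2 P := by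
    rw [hL]
    have h := (memLp_const (N / 2 * Real.log ((sβ : ℝ) / sα))).add ((hmem N).const_mul (c / 2))
    exact h
  have hclt : TendstoInDistribution
      (fun (N : ℕ) ω ↦ (√(N : ℝ))⁻¹ *
        (logLikelihoodRatio sα sβ y N ω - uncorrMean sα sβ s N))
      atTop (id : ℝ → ℝ) (fun _ ↦ P) (gaussianReal 0 (corrVar sα sβ s r 1).toNNReal) := by
    refine ⟨fun N ↦ ((hLmem N).aemeasurable.sub_const _).const_mul _, by fun_prop, ?_⟩
    refine ProbabilityMeasure.tendsto_iff_tendsto_charFun.2 fun t ↦ ?_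
    simp only [ProbabilityMeasure.coe_mk, Measure.map_id, hD]
    convert tendsto_charFun_sum_sq_sub hind hlaw hmax hlim (c / 2) t using 2
    rw [charFun_gaussianReal, Real.coe_toNNReal _ hcv0, hcv1]
    congr 1
    push_cast
    ring
  refine ⟨hclt, fun hne hs0 ↦ ?_, fun N ↦ ⟨hLmem N, ?_⟩, ?_⟩
  · have hc0 : c ≠ 0 := by
      rw [hc, sub_ne_zero]
      intro h
      exact hne (NNReal.coe_injective (inv_injective h)).symm
    have hpos : 0 < corrVar sα sβ s r 1 := by rw [hcv1, hτ]; positivity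
    have h := hclt.continuous_comp (g := fun z ↦ (√(corrVar sα sβ s r 1))⁻¹ * z) (by fun_prop)
    -- `corrVar` is linear in `N`, so the standardized ratio is a fixed multiple of the `√N` scaling
    have e : (fun (N : ℕ) ω ↦ (√(corrVar sα sβ s r N))⁻¹ *
        (logLikelihoodRatio sα sβ y N ω - uncorrMean sα sβ s N)) =
        fun (N : ℕ) ↦ (fun z ↦ (√(corrVar sα sβ s r 1))⁻¹ * z) ∘ fun ω ↦ (√(N : ℝ))⁻¹ *
          (logLikelihoodRatio sα sβ y N ω - uncorrMean sα sβ s N) := by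
      ext N ω
      rw [hcv N, ← hcv1, Real.sqrt_mul (Nat.cast_nonneg _), mul_inv, Function.comp_apply]
      ring
    have hlimit : (gaussianReal 0 1).map id = (gaussianReal 0 (corrVar sα sβ s r 1).toNNReal).map
        ((fun z ↦ (√(corrVar sα sβ s r 1))⁻¹ * z) ∘ id) := by
      rw [Measure.map_id, Function.comp_id, gaussianReal_map_const_mul]
      congr 1
      · simp
      · ext
        simp [Real.sq_sqrt hcv0, Real.coe_toNNReal _ hcv0, hpos.ne']
    rw [e]
    refine ⟨h.forall_aemeasurable, by fun_prop, ?_⟩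
    have ht := h.tendsto
    simp only [← hlimit] at ht
    exact ht
  · rw [hL, integral_add (integrable_const _) (((hmem N).integrable one_le_two).const_mul _),
      integral_const, integral_const_mul, integral_sum_sq_of_hasLaw (hlaw N), hsum, uncorrMean,
      probReal_univ, one_smul]
    ring
  · rw [hcv1]
    refine (hlim.const_mul (c ^ 2 / 2)).congr fun N ↦ ?_
    rw [hL, variance_const_add ((hmem N).aestronglyMeasurable.const_mul _), variance_const_mul,
      variance_sum_sq_of_iIndepFun (hind N) (hlaw N)]
    ring
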